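/- Conventions. Fix $k\in\{1,2,\dots,\infty\}$; "smooth" means $C^k$. A Lie subgroup $G$ of $\mathrm{GL}(n,\mathbb R)$ is a subgroup endowed with a (second-countable, Hausdorff) topology and a smooth structure for which it is a Lie group and the inclusion is a smooth immersion. It acts on $\mathbb R^n$ by $(g,x)\mapsto gx$ (matrix times vector), with isotropy groups $G_x=\{g\in G: gx=x\}$. The action is *free at* $\overline x$ if $G_{\overline x}=\{e\}$. It is *typical at* $\overline x$ if, for some open $U\ni\overline x$, the set $\{g\in G: U\cap gU\neq\emptyset\}$ has compact closure in $G$, and $G_x$ is conjugate to $G_{\overline x}$ in $G$ for all $x$ near $\overline x$. For $f:\mathbb R^n\to\mathbb R\cup\{\infty\}$, let $\mathrm{dom} f=\{x: f(x)<\infty\}$. At $x\in\mathrm{dom} f$ let $\widehat\partial f(x)$ be the set of $v$ with $f(y)\ge f(x)+\langle v,y-x\rangle+o(|y-x|)$ for $y$ near $x$; let $\partial f(x)$ be the set of limits of sequences $v_i\in\widehat\partial f(x_i)$ with $x_i\to x$ and $f(x_i)\to f(x)$; let $\partial^\infty f(x)$ be the set of limits of $\tau_iv_i$ with $\tau_i\searrow0$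 and $v_i\in\widehat\partial f(x_i)$, $x_i\to x$, $f(x_i)\to f(x)$; and let $\overline\partial f(x)=\overline{\mathrm{co}}\,[\partial f(x)+\partial^\infty f(x)]$ be the Clarke subdifferential. All these sets are empty where $f(x)=\infty$; $\mathrm{dom}\,\partial f=\{x:\partial f(x)\ne\emptyset\}$. The function $f$ is *Lipschitz continuous near* $\overline x$ if, for some $L>0$, $|f(x)-f(y)|\le L|x-y|$ for all $x,y\in\mathrm{dom} f$ near $\overline x$. It is *regular at* $\overline x$ if $f(\overline x)$ is finite and, at the point $(\overline x,f(\overline x))$, the epigraph of $f$ is locally closed and its regular normal cone equals its limiting normal cone. Here the regular normal cone $\widehat N_S(z)$ of a set $S$ at $z\in S$ is the set of $v$ with $\langle v,y-z\rangle\le o(|y-z|)$ for $y\in S$ near $z$, and the limiting normal cone at $z$ is the set of limits of sequences $v_i\in\widehat N_S(z_i)$ with $z_i\in S$, $z_i\to z$. **Statement.** Let $f:\mathbb R^n\to\mathbb R\cup\{\infty\}$ be invariant under the natural action of a Lie subgroup $G$ of $\mathrm{GL}(n,\mathbb R)$, i.e. $f(gx)=f(x)$ for all $g\in G$, $x\in\mathbb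 R^n$. Let $\mathfrak g=T_{I_n}G\subset\mathbb R^{n\times n}$ be its Lie algebra, $\mathrm s(\mathfrak g)$ the subspace of symmetric matrices in $\mathfrak g$, and $C(x)=P_{\mathrm s(\mathfrak g)}(xx^T)$, where $P_{\mathrm s(\mathfrak g)}$ is the orthogonal projection onto $\mathrm s(\mathfrak g)$ for the Frobenius inner product. Fix $\overline x\in\mathrm{dom} f$ and suppose that at least one of the following holds: 1. the action is free at $\overline x$ or typical at $\overline x$; 2. $\overline x\in\mathrm{int}\,\mathrm{dom} f$ and $f$ is Lipschitz continuous near $\overline x$, or $f$ is regular at $\overline x$. Then there is an open neighborhood $U$ of $\overline x$ such that for all $x\in U\cap\mathrm{dom}\,\partial f$ and all $v\in\overline\partial f(x)$, $$C(x+\alpha v)=C(x)+\alpha^2C(v)\ \text{ for all }\alpha\in\mathbb R,\qquad\text{and}\qquad dC(x)(v)=0,$$ $C$ being differentiable at $x$. In particular, $C$ is conserved in $U$ along the subgradient flow: let $J\subseteq\mathbb R$ be an interval and let $x(\cdot)$ be absolutely continuous on the compact subintervals of $J$ with $x'(t)\in-\overline\partial f(x(t))$ for almost every $t\in J$. Then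 $(C\circ x)'(t)=0$ for almost every $t\in J$ with $x(t)\in U$, and $C\circ x$ is constant on every interval $I\subseteq J$ such that $x(I)\subseteq U$. -/

import Mathlib

open Set Filter Topology MeasureTheory
open scoped Manifold ContDiff InnerProductSpace Pointwise

/-! ### Variational analysis in a Euclidean space -/

section VariationalAnalysis

variable {E : Type*} [NormedAddCommGroup E] [InnerProductSpace ℝ E]

/-- The effective domain of an extended real-valued function. -/
def effDom (f : E → EReal) : Set E := {x | f x < ⊤}

/-- The epigraph of `f`, as a subset of the Euclidean space `E × ℝ`. -/
def epigraph (f : E → EReal) : Set (WithLp 2 (E × ℝ)) := {p | f p.fst ≤ (p.snd : EReal)}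

/-- The regular normal cone of `S` at a point `x` of `S`: the vectors `v` with
`⟪v, y - x⟫ ≤ o(‖y - x‖)` as `y → x` in `S`. -/
def regularNormalCone (S : Set E) (x : E) : Set E :=
  {v | ∀ ε : ℝ, 0 < ε → ∀ᶠ y in 𝓝[S] x, ⟪v, y - x⟫_ℝ ≤ ε * ‖y - x‖}

/-- The (limiting) normal cone of `S` at `x`. -/
def normalCone (S : Set E) (x : E) : Set E :=
  {v | ∃ (y : ℕ → E) (w : ℕ → E), (∀ i, y i ∈ S) ∧ (∀ i, w i ∈ regularNormalCone S (y i)) ∧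
    Tendsto y atTop (𝓝 x) ∧ Tendsto w atTop (𝓝 v)}

/-- `S` is regular at `x`: `x` belongs to `S`, `S` is locally closed at `x`, and the regular normal
cone and the normal cone of `S` at `x` agree. -/
def IsRegularSetAt (S : Set E) (x : E) : Prop :=
  x ∈ S ∧ (∃ V ∈ 𝓝 x, IsClosed V ∧ IsClosed (S ∩ V)) ∧ regularNormalCone S x = normalCone S x

/-- `f` is regular at `x`: `f x` is finite and the epigraph of `f` is regular at `(x, f x)`. -/
def IsRegularFunAt (f : E → EReal) (x : E) : Prop :=
  f x ≠ ⊥ ∧ f x ≠ ⊤ ∧ IsRegularSetAt (epigraph f) (WithLp.toLp 2 (x, (f x).toReal))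

/-- `f` is Lipschitz continuous near `x`: for some `L > 0`, the inequality
`|f y - f z| ≤ L ‖y - z‖` holds for all `y, z` in the domain of `f` near `x`. -/
def IsLipschitzNear (f : E → EReal) (x : E) : Prop :=
  ∃ L : ℝ, 0 < L ∧ ∃ U ∈ 𝓝 x, ∀ y ∈ U ∩ effDom f, ∀ z ∈ U ∩ effDom f,
    |(f y).toReal - (f z).toReal| ≤ L * ‖y - z‖

/-- The regular subdifferential of `f` at `x`: if `f x` is finite, the vectors `v` with
`f y ≥ f x + ⟪v, y - x⟫ + o(‖y - x‖)` near `x`; otherwise empty. -/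
def regularSubdiff (f : E → EReal) (x : E) : Set E :=
  {v | f x ≠ ⊥ ∧ f x ≠ ⊤ ∧ ∀ ε : ℝ, 0 < ε → ∀ᶠ y in 𝓝 x,
    (((f x).toReal + ⟪v, y - x⟫_ℝ - ε * ‖y - x‖ : ℝ) : EReal) ≤ f y}

/-- The (limiting) subdifferential `∂f(x)`. -/
def limitingSubdiff (f : E → EReal) (x : E) : Set E :=
  {v | f x ≠ ⊥ ∧ f x ≠ ⊤ ∧ ∃ (y : ℕ → E) (w : ℕ → E), (∀ i, w i ∈ regularSubdiff f (y i)) ∧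
    Tendsto y atTop (𝓝 x) ∧ Tendsto (fun i => f (y i)) atTop (𝓝 (f x)) ∧
    Tendsto w atTop (𝓝 v)}

/-- The horizon subdifferential `∂^∞f(x)`. -/
def horizonSubdiff (f : E → EReal) (x : E) : Set E :=
  {v | f x ≠ ⊥ ∧ f x ≠ ⊤ ∧ ∃ (y : ℕ → E) (w : ℕ → E) (τ : ℕ → ℝ),
    (∀ i, w i ∈ regularSubdiff f (y i)) ∧ (∀ i, 0 < τ i) ∧ Tendsto τ atTop (𝓝 0) ∧
    Tendsto y atTop (𝓝 x) ∧ Tendsto (fun i => f (y i)) atTop (𝓝 (f x)) ∧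
    Tendsto (fun i => τ i • w i) atTop (𝓝 v)}

/-- The Clarke subdifferential: the closed convex hull of the Minkowski sum `∂f(x) + ∂^∞f(x)`. -/
def clarkeSubdiff (f : E → EReal) (x : E) : Set E :=
  closure (convexHull ℝ (limitingSubdiff f x + horizonSubdiff f x))

/-- `x` is a solution on the interval `J` of the differential inclusion
`x'(t) ∈ - clarkeSubdiff f (x t)` for almost every `t ∈ J`: it is absolutely continuous on every
compact subinterval of `J` and satisfies the inclusion almost everywhere in `J`. -/
def IsSubgradientTrajectory (f : E → EReal) (J : Set ℝ) (x : ℝ → E) : Prop :=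
  (∀ a ∈ J, ∀ b ∈ J, AbsolutelyContinuousOnInterval x a b) ∧
    ∀ᵐ t ∂volume.restrict J, ∃ v ∈ clarkeSubdiff f (x t), HasDerivAt x (-v) t

end VariationalAnalysis

/-! ### Lie subgroups of `GL(n, ℝ)` and their natural action -/

/-- The space of real `n × n` matrices, identified by their entries, with the Frobenius inner product
`⟪A, B⟫ = ∑ i j, A i j * B i j`, that is, the Euclidean space of families indexed by pairs. -/
abbrev MatSpace (n : ℕ) : Type := EuclideanSpace ℝ (Fin n × Fin n)

/-- A matrix as an element of `MatSpace n`. -/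
def toMatSpace {n : ℕ} (A : Matrix (Fin n) (Fin n) ℝ) : MatSpace n :=
  WithLp.toLp 2 fun p => A p.1 p.2

section NaturalAction

variable {n : ℕ} {G : Type*} [Group G]

/-- The inclusion of `G` into the space of matrices. -/
def inclMat (ι : G →* GL (Fin n) ℝ) (g : G) : MatSpace n :=
  toMatSpace (ι g : Matrix (Fin n) (Fin n) ℝ)

/-- `G`, a Lie group of class `C^k` and dimension `d`, is a Lie subgroup of `GL(n, ℝ)` through the
inclusion `ι`: `ι` is an injective group homomorphism and an immersion of class `C^k`. Here
`GL(n, ℝ)` carries its structure of open submanifold of the space of `n × n` matrices, so that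
smoothness and differentials are those of the matrix-valued map `inclMat ι`. -/
structure IsLieSubgroup (d : ℕ) (k : ℕ∞) [TopologicalSpace G]
    [ChartedSpace (EuclideanSpace ℝ (Fin d)) G] (ι : G →* GL (Fin n) ℝ) : Prop where
  injective : Function.Injective ι
  contMDiff : ContMDiff 𝓘(ℝ, EuclideanSpace ℝ (Fin d)) 𝓘(ℝ, MatSpace n) k (inclMat ι)
  mfderiv_injective : ∀ g : G, Function.Injective
    (mfderiv 𝓘(ℝ, EuclideanSpace ℝ (Fin d)) 𝓘(ℝ, MatSpace n) (inclMat ι) g)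

/-- The Lie algebra of the Lie subgroup `G`: its tangent space at the identity, as a space of
matrices (the image of the differential of the inclusion at the identity). -/
noncomputable def lieAlg (d : ℕ) [TopologicalSpace G]
    [ChartedSpace (EuclideanSpace ℝ (Fin d)) G] (ι : G →* GL (Fin n) ℝ) :
    Submodule ℝ (MatSpace n) :=
  (mfderiv 𝓘(ℝ, EuclideanSpace ℝ (Fin d)) 𝓘(ℝ, MatSpace n) (inclMat ι) (1 : G)).range

/-- The subspace of symmetric elements of a space of matrices. -/
def symmPart (L : Submodule ℝ (MatSpace n)) : Submodule ℝ (MatSpace n) where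
  carrier := {A | A ∈ L ∧ ∀ i j, A (i, j) = A (j, i)}
  add_mem' hA hB := ⟨L.add_mem hA.1 hB.1, fun i j => by simp [hA.2 i j, hB.2 i j]⟩
  zero_mem' := ⟨L.zero_mem, fun _ _ => rfl⟩
  smul_mem' c _ hA := ⟨L.smul_mem c hA.1, fun i j => by simp [hA.2 i j]⟩

/-- The map `C(x) = P_S(x xᵀ)`, where `S` is the space of symmetric elements of the Lie algebra of
`G` and `P_S` is the projection onto `S` for the Frobenius inner product. -/
noncomputable def conservedMap (d : ℕ) [TopologicalSpace G]
    [ChartedSpace (EuclideanSpace ℝ (Fin d)) G] (ι : G →* GL (Fin n) ℝ)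
    (x : EuclideanSpace ℝ (Fin n)) : MatSpace n :=
  (symmPart (lieAlg d ι)).starProjection (toMatSpace (Matrix.vecMulVec x.ofLp x.ofLp))

/-- The natural action `g x`: the matrix of `g` times the vector `x`. -/
def natAct (ι : G →* GL (Fin n) ℝ) (g : G) (x : EuclideanSpace ℝ (Fin n)) :
    EuclideanSpace ℝ (Fin n) :=
  WithLp.toLp 2 ((ι g : Matrix (Fin n) (Fin n) ℝ).mulVec x.ofLp)

theorem natAct_one (ι : G →* GL (Fin n) ℝ) (x : EuclideanSpace ℝ (Fin n)) :
    natAct ι 1 x = x := by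
  simp [natAct]

theorem natAct_mul (ι : G →* GL (Fin n) ℝ) (g h : G) (x : EuclideanSpace ℝ (Fin n)) :
    natAct ι (g * h) x = natAct ι g (natAct ι h x) := by
  simp [natAct, Matrix.mulVec_mulVec]

/-- The isotropy group of `x`. -/
def isotropyGroup (ι : G →* GL (Fin n) ℝ) (x : EuclideanSpace ℝ (Fin n)) : Subgroup G where
  carrier := {g | natAct ι g x = x}
  mul_mem' {g h} hg hh := by
    change natAct ι (g * h) x = x
    rw [natAct_mul, show natAct ι h x = x from hh]
    exact hg
  one_mem' := natAct_one ι x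
  inv_mem' {g} hg := by
    change natAct ι g⁻¹ x = x
    conv_lhs => rw [← show natAct ι g x = x from hg]
    rw [← natAct_mul, inv_mul_cancel, natAct_one]

/-- The action is free at `x`: the isotropy group of `x` is trivial. -/
def IsFreeAt (ι : G →* GL (Fin n) ℝ) (x : EuclideanSpace ℝ (Fin n)) : Prop :=
  isotropyGroup ι x = ⊥

/-- The action is proper near `x`: for some open `U` containing `x`, the set of `g` such that `U`
meets `g U` has compact closure in `G`. -/
def IsProperNear [TopologicalSpace G] (ι : G →* GL (Fin n) ℝ)
    (x : EuclideanSpace ℝ (Fin n)) : Prop :=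
  ∃ U : Set (EuclideanSpace ℝ (Fin n)), IsOpen U ∧ x ∈ U ∧
    IsCompact (closure {g : G | (U ∩ natAct ι g '' U).Nonempty})

/-- Two points have the same orbit type: their isotropy groups are conjugate. -/
def SameOrbitType (ι : G →* GL (Fin n) ℝ) (x y : EuclideanSpace ℝ (Fin n)) : Prop :=
  ∃ g : G, isotropyGroup ι x = (isotropyGroup ι y).map (MulAut.conj g).toMonoidHom

/-- The action is typical at `x`: it is proper near `x` and the orbit type is constant near `x`. -/
def IsTypicalAt [TopologicalSpace G] (ι : G →* GL (Fin n) ℝ)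
    (x : EuclideanSpace ℝ (Fin n)) : Prop :=
  IsProperNear ι x ∧ ∀ᶠ y in 𝓝 x, SameOrbitType ι y x

end NaturalAction

/-! ### Regular subgradients and curves in level sets -/

section Subgradients

variable {E : Type*} [NormedAddCommGroup E] [InnerProductSpace ℝ E]

/-! Each `A` in the Lie algebra is the velocity at the identity of a curve `g` in the group. An
invariant `f` is constant along `t ↦ g(t) x`, so regular subgradients at `x` are orthogonal to `A
x`. Since `x ↦ A x` is continuous and orthogonality is a closed linear condition on the subgradient,
it passes to limits, horizon limits and closed convex hulls, hence to Clarke subgradients `v`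
(`inner_eq_zero_of_mem_clarkeSubdiff`).

For symmetric `A`, `⟪A, x vᵀ + v xᵀ⟫ = 2 ⟪v, A x⟫ = 0`, so the projection kills the cross term of
`(x + α v)(x + α v)ᵀ` (`conservedMap_add_smul`). Thus `C` has zero derivative at `x` along `v`, and
by the chain rule an absolutely continuous trajectory keeps `C` constant. -/

theorem inner_deriv_nonpos_of_mem_regularSubdiff {f : E → EReal} {v w : E} {γ : ℝ → E}
    (hv : v ∈ regularSubdiff f (γ 0)) (hγ : HasDerivAt γ w 0) (hf : ∀ t, f (γ t) = f (γ 0)) :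
    ⟪v, w⟫_ℝ ≤ 0 := by
  obtain ⟨hbot, htop, hv⟩ := hv
  have hslope : Tendsto (fun t : ℝ => t⁻¹ • (γ t - γ 0)) (𝓝[>] 0) (𝓝 w) := by
    simpa using hγ.tendsto_slope_zero_right
  have hbound : ∀ ε : ℝ, 0 < ε → ⟪v, w⟫_ℝ ≤ ε * ‖w‖ := by
    intro ε hε
    refine le_of_tendsto_of_tendsto (tendsto_const_nhds.inner hslope)
      (hslope.norm.const_mul ε) ?_
    filter_upwards [(hγ.continuousAt.eventually (hv ε hε)).filter_mono nhdsWithin_le_nhds,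
      self_mem_nhdsWithin] with t ht htpos
    -- As `f (γ t) = f (γ 0)` is finite, the two values cancel and leave `⟪v, γ t - γ 0⟫ ≤ ε ‖γ t -
    -- γ 0‖`, to be divided by `t > 0`.
    rw [hf t, ← EReal.coe_toReal htop hbot, EReal.coe_le_coe_iff, EReal.toReal_coe] at ht
    have htpos : 0 < t⁻¹ := inv_pos.mpr htpos
    rw [inner_smul_right, norm_smul, Real.norm_of_nonneg htpos.le]
    have := mul_le_mul_of_nonneg_left (show ⟪v, γ t - γ 0⟫_ℝ ≤ ε * ‖γ t - γ 0‖ by linarith)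
      htpos.le
    linarith
  refine ge_of_tendsto (x := 𝓝[>] (0 : ℝ)) (f := fun ε : ℝ => ε * ‖w‖) ?_
    (eventually_mem_nhdsWithin.mono hbound)
  have : Tendsto (fun ε : ℝ => ε * ‖w‖) (𝓝 0) (𝓝 (0 * ‖w‖)) := tendsto_id.mul_const _
  rw [zero_mul] at this
  exact this.mono_left nhdsWithin_le_nhds

/-- A regular subgradient is orthogonal to the velocity of a curve along which `f` is constant. -/
theorem inner_deriv_eq_zero_of_mem_regularSubdiff {f : E → EReal} {v w : E} {γ : ℝ → E}
    (hv : v ∈ regularSubdiff f (γ 0)) (hγ : HasDerivAt γ w 0) (hf : ∀ t, f (γ t) = f (γ 0)) :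
    ⟪v, w⟫_ℝ = 0 := by
  refine le_antisymm (inner_deriv_nonpos_of_mem_regularSubdiff hv hγ hf) ?_
  -- Reversing time gives the opposite inequality.
  have hγ' : HasDerivAt (fun t : ℝ => γ (-t)) (-w) 0 := by
    have : HasDerivAt γ w (-0) := by simpa using hγ
    simpa [Function.comp_def] using this.scomp (0 : ℝ) (hasDerivAt_neg (0 : ℝ))
  have := inner_deriv_nonpos_of_mem_regularSubdiff (γ := fun t : ℝ => γ (-t)) (w := -w)
    (by simpa using hv) hγ' (fun t => by simpa using hf (-t))
  rw [inner_neg_right] at this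
  linarith

/-- A continuous vector field that is orthogonal to all regular subgradients is orthogonal to all
Clarke subgradients. -/
theorem inner_eq_zero_of_mem_clarkeSubdiff {f : E → EReal} {X : E → E} (hX : Continuous X)
    (h : ∀ y, ∀ w ∈ regularSubdiff f y, ⟪w, X y⟫_ℝ = 0) {x v : E} (hv : v ∈ clarkeSubdiff f x) :
    ⟪v, X x⟫_ℝ = 0 := by
  have hlim : ∀ w ∈ limitingSubdiff f x, ⟪w, X x⟫_ℝ = 0 := by
    rintro w ⟨-, -, y, u, hu, hy, -, hw⟩
    refine tendsto_nhds_unique (hw.inner ((hX.tendsto x).comp hy)) ?_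
    simp [h _ _ (hu _)]
  have hhor : ∀ w ∈ horizonSubdiff f x, ⟪w, X x⟫_ℝ = 0 := by
    rintro w ⟨-, -, y, u, τ, hu, -, -, hy, -, hw⟩
    refine tendsto_nhds_unique (hw.inner ((hX.tendsto x).comp hy)) ?_
    simp [inner_smul_left, h _ _ (hu _)]
  -- The hyperplane orthogonal to `X x` is closed and convex, so it absorbs the closed convex hull.
  let K : Submodule ℝ E := (innerₗ E (X x)).ker
  have hK : IsClosed (K : Set E) := by
    have : (K : Set E) = {w | ⟪X x, w⟫_ℝ = 0} := by ext; simp [K]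
    rw [this]
    exact isClosed_eq (by fun_prop) continuous_const
  have hsub : clarkeSubdiff f x ⊆ K := by
    refine closure_minimal (convexHull_min ?_ K.convex) hK
    rintro _ ⟨a, ha, b, hb, rfl⟩
    simp [K, inner_add_right, real_inner_comm, hlim a ha, hhor b hb]
  have := hsub hv
  rw [real_inner_comm]
  simpa [K] using this

/-- A Minkowski sum with an empty summand is empty, so Clarke subgradients exist only on `dom ∂f`.
-/
theorem limitingSubdiff_nonempty_of_mem_clarkeSubdiff {f : E → EReal} {x v : E}
    (hv : v ∈ clarkeSubdiff f x) : (limitingSubdiff f x).Nonempty := by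
  have : (clarkeSubdiff f x).Nonempty := ⟨v, hv⟩
  rw [clarkeSubdiff, closure_nonempty_iff, convexHull_nonempty_iff] at this
  exact this.of_add_left

end Subgradients

/-! ### Absolutely continuous curves -/

/-- The image of an absolutely continuous curve under a continuously differentiable map is
absolutely continuous. -/
theorem ContDiff.comp_absolutelyContinuousOnInterval {E F : Type*} [NormedAddCommGroup E]
    [NormedSpace ℝ E] [ProperSpace E] [NormedAddCommGroup F] [NormedSpace ℝ F] {φ : E → F}
    (hφ : ContDiff ℝ 1 φ) {x : ℝ → E} {a b : ℝ} (hx : AbsolutelyContinuousOnInterval x a b) :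
    AbsolutelyContinuousOnInterval (fun t => φ (x t)) a b := by
  -- The curve stays in a closed ball, which is compact and convex, so `φ` is Lipschitz there.
  obtain ⟨R, hR⟩ := hx.exists_bound
  obtain ⟨K, hK⟩ := (hφ.contDiffOn (s := Metric.closedBall (0 : E) R)).exists_lipschitzOnWith
    one_ne_zero (convex_closedBall _ _) (isCompact_closedBall _ _)
  have hmem : ∀ t ∈ uIcc a b, x t ∈ Metric.closedBall (0 : E) R := fun t ht => by
    simpa using hR t ht
  refine squeeze_zero' (Eventually.of_forall fun _ => Finset.sum_nonneg fun _ _ => dist_nonneg) ?_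
    (by simpa using Tendsto.const_mul (K : ℝ) hx)
  rw [eventually_inf_principal]
  refine Eventually.of_forall fun I hI => ?_
  rw [Finset.mul_sum]
  exact Finset.sum_le_sum fun i hi =>
    hK.dist_le_mul _ (hmem _ (hI.1 i hi).1) _ (hmem _ (hI.1 i hi).2)

/-! ### The natural action and the conserved map -/

section NaturalAction

variable {n : ℕ} {G : Type*} [Group G]

/-- The product of a matrix and a vector, as a bilinear map. -/
noncomputable def matAct (n : ℕ) :
    MatSpace n →ₗ[ℝ] EuclideanSpace ℝ (Fin n) →ₗ[ℝ] EuclideanSpace ℝ (Fin n) :=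
  LinearMap.mk₂ ℝ (fun A x => WithLp.toLp 2 fun i => ∑ j, A (i, j) * x j)
    (fun A B x => by ext i; simp [add_mul, Finset.sum_add_distrib])
    (fun c A x => by ext i; simp [mul_assoc, Finset.mul_sum])
    (fun A x y => by ext i; simp [mul_add, Finset.sum_add_distrib])
    (fun c A x => by ext i; simp [mul_left_comm, Finset.mul_sum])

@[simp]
theorem matAct_apply (A : MatSpace n) (x : EuclideanSpace ℝ (Fin n)) (i : Fin n) :
    matAct n A x i = ∑ j, A (i, j) * x j := rfl

theorem natAct_eq_matAct (ι : G →* GL (Fin n) ℝ) (g : G) (x : EuclideanSpace ℝ (Fin n)) :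
    natAct ι g x = matAct n (inclMat ι g) x := rfl

/-- Every element of the Lie algebra is the velocity at the identity of a curve in the group. -/
theorem exists_curve_of_mem_lieAlg {d : ℕ} {k : ℕ∞} (hk : 1 ≤ k) [TopologicalSpace G]
    [ChartedSpace (EuclideanSpace ℝ (Fin d)) G] {ι : G →* GL (Fin n) ℝ} (hι : IsLieSubgroup d k ι)
    {A : MatSpace n} (hA : A ∈ lieAlg d ι) :
    ∃ g : ℝ → G, g 0 = 1 ∧ HasDerivAt (fun t => inclMat ι (g t)) A 0 := by
  obtain ⟨w, rfl⟩ := hA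
  change EuclideanSpace ℝ (Fin d) at w
  have hk0 : ((k : ℕ∞) : WithTop ℕ∞) ≠ 0 := by
    have : k ≠ 0 := fun h => by simp [h] at hk
    exact_mod_cast this
  let φ := extChartAt 𝓘(ℝ, EuclideanSpace ℝ (Fin d)) (1 : G)
  have hd := ((hι.contMDiff.mdifferentiable hk0) 1).hasMFDerivAt.2
  -- The curve is a straight line in the chart at the identity. `φ.symm` is total, so it lies in `G`
  -- for all `t`; only its germ at `0` matters for the derivative.
  refine ⟨fun t => φ.symm (φ 1 + t • w), by simp [φ], ?_⟩
  have hline : HasDerivAt (fun t : ℝ => φ 1 + t • w) w 0 := by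
    simpa using ((hasDerivAt_id (0 : ℝ)).smul_const w).const_add (φ 1)
  have hd' : HasFDerivWithinAt (writtenInExtChartAt 𝓘(ℝ, EuclideanSpace ℝ (Fin d)) 𝓘(ℝ, MatSpace n) 1
      (inclMat ι)) (mfderiv 𝓘(ℝ, EuclideanSpace ℝ (Fin d)) 𝓘(ℝ, MatSpace n) (inclMat ι) 1)
      univ (φ 1 + (0 : ℝ) • w) := by
    rw [zero_smul, add_zero, ← range_id]
    exact hd
  exact (hasFDerivWithinAt_univ.1 hd').comp_hasDerivAt (0 : ℝ) hline

/-- Regular subgradients of an invariant function at `x` are orthogonal to `A x`, for all `A` in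
the Lie algebra. -/
theorem inner_matAct_eq_zero_of_mem_regularSubdiff {d : ℕ} {k : ℕ∞} (hk : 1 ≤ k)
    [TopologicalSpace G] [ChartedSpace (EuclideanSpace ℝ (Fin d)) G] {ι : G →* GL (Fin n) ℝ}
    (hι : IsLieSubgroup d k ι) {f : EuclideanSpace ℝ (Fin n) → EReal}
    (hf : ∀ (g : G) (x : EuclideanSpace ℝ (Fin n)), f (natAct ι g x) = f x)
    {A : MatSpace n} (hA : A ∈ lieAlg d ι) (x v : EuclideanSpace ℝ (Fin n))
    (hv : v ∈ regularSubdiff f x) : ⟪v, matAct n A x⟫_ℝ = 0 := by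
  obtain ⟨g, hg, hd⟩ := exists_curve_of_mem_lieAlg hk hι hA
  have hg0 : natAct ι (g 0) x = x := by rw [hg, natAct_one]
  refine inner_deriv_eq_zero_of_mem_regularSubdiff (f := f) (γ := fun t => natAct ι (g t) x)
    (by rwa [hg0]) ?_ (fun t => by simp only [hf])
  exact ((LinearMap.toContinuousLinearMap ((matAct n).flip x)).hasFDerivAt).comp_hasDerivAt
    (0 : ℝ) hd

/-- The matrix `x yᵀ`, as a bilinear map. -/
noncomputable def outerProd (n : ℕ) :
    EuclideanSpace ℝ (Fin n) →ₗ[ℝ] EuclideanSpace ℝ (Fin n) →ₗ[ℝ] MatSpace n :=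
  LinearMap.mk₂ ℝ (fun x y => toMatSpace (Matrix.vecMulVec x.ofLp y.ofLp))
    (fun x x' y => by ext p; simp [toMatSpace, Matrix.vecMulVec_apply, add_mul])
    (fun c x y => by ext p; simp [toMatSpace, Matrix.vecMulVec_apply, mul_assoc])
    (fun x y y' => by ext p; simp [toMatSpace, Matrix.vecMulVec_apply, mul_add])
    (fun c x y => by ext p; simp [toMatSpace, Matrix.vecMulVec_apply, mul_left_comm])

@[simp]
theorem outerProd_apply (x y : EuclideanSpace ℝ (Fin n)) (i j : Fin n) :
    outerProd n x y (i, j) = x i * y j := rfl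

/-- Both sides are `xᵀ A y`. This turns orthogonality of vectors to `A y` into Frobenius
orthogonality to `A`. -/
theorem inner_outerProd (A : MatSpace n) (x y : EuclideanSpace ℝ (Fin n)) :
    ⟪A, outerProd n x y⟫_ℝ = ⟪x, matAct n A y⟫_ℝ := by
  simp only [PiLp.inner_apply, Fintype.sum_prod_type, outerProd_apply, matAct_apply,
    RCLike.inner_apply, conj_trivial, Finset.sum_mul]
  exact Finset.sum_congr rfl fun i _ => Finset.sum_congr rfl fun j _ => by ring

/-- Transposition is a Frobenius isometry that fixes `A` and exchanges `x yᵀ` with `y xᵀ`. -/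
theorem inner_outerProd_comm {A : MatSpace n} (hA : ∀ i j, A (i, j) = A (j, i))
    (x y : EuclideanSpace ℝ (Fin n)) : ⟪A, outerProd n x y⟫_ℝ = ⟪A, outerProd n y x⟫_ℝ := by
  simp only [PiLp.inner_apply, Fintype.sum_prod_type, outerProd_apply, RCLike.inner_apply,
    conj_trivial]
  rw [Finset.sum_comm]
  exact Finset.sum_congr rfl fun i _ => Finset.sum_congr rfl fun j _ => by rw [hA]; ring

variable {d : ℕ} [TopologicalSpace G] [ChartedSpace (EuclideanSpace ℝ (Fin d)) G]

theorem conservedMap_eq (ι : G →* GL (Fin n) ℝ) (x : EuclideanSpace ℝ (Fin n)) :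
    conservedMap d ι x = (symmPart (lieAlg d ι)).starProjection (outerProd n x x) := rfl

theorem contDiff_conservedMap (ι : G →* GL (Fin n) ℝ) : ContDiff ℝ 1 (conservedMap d ι) := by
  refine (ContinuousLinearMap.contDiff _).comp (contDiff_euclidean.2 fun p => ?_)
  change ContDiff ℝ 1 fun x : EuclideanSpace ℝ (Fin n) => x p.1 * x p.2
  fun_prop

/-- If `v` is orthogonal to `A x` for all symmetric `A` in the Lie algebra, then the cross term in
the expansion of `C(x + α v)` vanishes. -/
theorem conservedMap_add_smul (ι : G →* GL (Fin n) ℝ) {x v : EuclideanSpace ℝ (Fin n)}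
    (h : ∀ A ∈ symmPart (lieAlg d ι), ⟪v, matAct n A x⟫_ℝ = 0) (α : ℝ) :
    conservedMap d ι (x + α • v) = conservedMap d ι x + α ^ 2 • conservedMap d ι v := by
  have hcross : (symmPart (lieAlg d ι)).starProjection (outerProd n x v + outerProd n v x) = 0 := by
    rw [Submodule.starProjection_apply_eq_zero_iff, Submodule.mem_orthogonal]
    intro A hA
    rw [inner_add_right, inner_outerProd_comm hA.2 x v, inner_outerProd, h A hA, add_zero]
  have hexp : outerProd n (x + α • v) (x + α • v) = outerProd n x x +
      α • (outerProd n x v + outerProd n v x) + α ^ 2 • outerProd n v v := by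
    simp only [map_add, map_smul, LinearMap.add_apply, LinearMap.smul_apply, smul_add, smul_smul,
      sq]
    abel
  rw [conservedMap_eq, conservedMap_eq, conservedMap_eq, hexp, map_add, map_add, map_smul, map_smul,
    hcross, smul_zero, add_zero]

/-- On the line `x + t v`, the expansion of `C` has no term linear in `t`. -/
theorem fderiv_conservedMap_eq_zero (ι : G →* GL (Fin n) ℝ) {x v : EuclideanSpace ℝ (Fin n)}
    (h : ∀ A ∈ symmPart (lieAlg d ι), ⟪v, matAct n A x⟫_ℝ = 0) :
    fderiv ℝ (conservedMap d ι) x v = 0 := by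
  have hdiff : DifferentiableAt ℝ (conservedMap d ι) x :=
    (contDiff_conservedMap ι).differentiable one_ne_zero x
  have h1 := hdiff.hasFDerivAt.hasLineDerivAt v
  have h2 : HasDerivAt (fun t : ℝ => conservedMap d ι (x + t • v)) 0 0 := by
    simp only [conservedMap_add_smul ι h]
    simpa using ((hasDerivAt_pow 2 (0 : ℝ)).smul_const (conservedMap d ι v)).const_add
      (conservedMap d ι x)
  exact HasDerivAt.unique h1 h2

end NaturalAction

theorem mainTheorem4 {n d : ℕ} {k : ℕ∞} (hk : 1 ≤ k)
    {G : Type*} [Group G] [TopologicalSpace G] [T2Space G] [SecondCountableTopology G]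
    [ChartedSpace (EuclideanSpace ℝ (Fin d)) G]
    [LieGroup 𝓘(ℝ, EuclideanSpace ℝ (Fin d)) k G]
    (ι : G →* GL (Fin n) ℝ) (hι : IsLieSubgroup d k ι)
    (f : EuclideanSpace ℝ (Fin n) → EReal) (hf_bot : ∀ x, f x ≠ ⊥)
    (hf_inv : ∀ (g : G) (x : EuclideanSpace ℝ (Fin n)), f (natAct ι g x) = f x)
    (xbar : EuclideanSpace ℝ (Fin n)) (hxbar : xbar ∈ effDom f)
    (h : (IsFreeAt ι xbar ∨ IsTypicalAt ι xbar) ∨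
      ((xbar ∈ interior (effDom f) ∧ IsLipschitzNear f xbar) ∨ IsRegularFunAt f xbar)) :
    ∃ U : Set (EuclideanSpace ℝ (Fin n)), IsOpen U ∧ xbar ∈ U ∧
      (∀ x ∈ U, (limitingSubdiff f x).Nonempty → ∀ v ∈ clarkeSubdiff f x,
        (∀ α : ℝ, conservedMap d ι (x + α • v) =
          conservedMap d ι x + α ^ 2 • conservedMap d ι v) ∧
        DifferentiableAt ℝ (conservedMap d ι) x ∧
        fderiv ℝ (conservedMap d ι) x v = 0) ∧
      (∀ (J : Set ℝ) (x : ℝ → EuclideanSpace ℝ (Fin n)), J.OrdConnected →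
        IsSubgradientTrajectory f J x →
        (∀ᵐ t ∂volume.restrict J, x t ∈ U →
          HasDerivAt (fun s => conservedMap d ι (x s)) 0 t) ∧
        ∀ I : Set ℝ, I ⊆ J → I.OrdConnected → (∀ t ∈ I, x t ∈ U) →
          ∀ s ∈ I, ∀ t ∈ I, conservedMap d ι (x s) = conservedMap d ι (x t)) := by
  have horth : ∀ x, ∀ v ∈ clarkeSubdiff f x, ∀ A ∈ symmPart (lieAlg d ι),
      ⟪v, matAct n A x⟫_ℝ = 0 := fun x v hv A hA =>
    inner_eq_zero_of_mem_clarkeSubdiff (matAct n A).continuous_of_finiteDimensional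
      (inner_matAct_eq_zero_of_mem_regularSubdiff hk hι hf_inv hA.1) hv
  have hdiff : Differentiable ℝ (conservedMap d ι) :=
    (contDiff_conservedMap ι).differentiable one_ne_zero
  -- The orthogonality holds at every point, so the whole space serves as the neighborhood.
  refine ⟨univ, isOpen_univ, mem_univ _, fun x _ _ v hv =>
    ⟨conservedMap_add_smul ι (horth x v hv), hdiff x,
      fderiv_conservedMap_eq_zero ι (horth x v hv)⟩, fun J x hJ ⟨hac, hsol⟩ => ?_⟩
  have hderiv : ∀ᵐ t ∂volume.restrict J, HasDerivAt (fun s => conservedMap d ι (x s)) 0 t := by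
    filter_upwards [hsol] with t ⟨v, hv, hxt⟩
    have := (hdiff (x t)).hasFDerivAt.comp_hasDerivAt t hxt
    rwa [map_neg, fderiv_conservedMap_eq_zero ι (horth (x t) v hv), neg_zero] at this
  refine ⟨hderiv.mono fun t ht _ => ht, fun I hIJ hI _ s hs t ht => ?_⟩
  -- The segment between `s` and `t` lies in `I ⊆ J`; on it `C ∘ x` is absolutely continuous with
  -- derivative zero almost everywhere.
  obtain ⟨c, hc⟩ := ((contDiff_conservedMap ι).comp_absolutelyContinuousOnInterval
    (hac s (hIJ hs) t (hIJ ht))).const_of_ae_hasDerivAt_zero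
    (((ae_restrict_iff' hJ.measurableSet).1 hderiv).mono fun r hr hrst =>
      hr (hIJ (hI.uIcc_subset hs ht hrst)))
  rw [hc s left_mem_uIcc, hc t right_mem_uIcc]
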